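/- For integers $n\ge 2k\ge 2$, the Schrijver graph $\mathrm{SG}(n,k)$ has as vertices the $k$-element subsets of $\{1,\dots,n\}$ that contain neither $\{i,i+1\}$ for any $i$ nor $\{1,n\}$; two vertices are adjacent iff they are disjoint. An odd topological $K_r$ subgraph of a graph $G$ consists of $r$ distinct branching vertices together with $\binom r2$ paths of odd length in $G$, one joining each pair of branching vertices, such that the paths are pairwise vertex-disjoint except for common ends and no path has a branching vertex in its interior. An odd $K_m$ minor of $G$ consists of $m$ pairwise vertex-disjoint trees $T_1,\dots,T_m$ in $G$ whose vertices can be simultaneously $2$-colored so that each $T_i$ is properly colored and, for every $i\ne j$, there is an edge of $G$ between a vertex of $T_i$ and a vertex of $T_j$ of the same color. **Corollary.** (a) For every integer $t\ge 5$ there is $N=N(t)$ such that for all $n\ge N$ and all $k$ with $n-2k+2=t$, the graph $\mathrm{SG}(n,k)$ contains an odd topological $K_t$ subgraph. (b) For every integer $t\ge 2$ there is $N=N(t)$ such that for all $n\ge N$ and all $k$ with $n-2k+2=t$, the graph $\mathrm{SG}(n,k)$ contains an odd $K_t$ minor. -/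

import Mathlib

/-- The Kneser graph `KG(n,k)`: vertices are the `k`-element subsets of `{1, …, n}`, two distinct
ones being adjacent iff they are disjoint. (For `k ≥ 1` disjoint vertices are distinct.) -/
def kneserGraph (n k : ℕ) :
    SimpleGraph {a : Finset ℕ // a ∈ Finset.powersetCard k (Finset.Icc 1 n)} where
  Adj a b := a ≠ b ∧ Disjoint a.1 b.1
  symm := ⟨fun _ _ h => ⟨h.1.symm, h.2.symm⟩⟩
  loopless := ⟨fun _ h => h.1 rfl⟩

/-- The vertex set of the Schrijver graph: the `k`-element subsets of `{1, …, n}` containing neither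
two consecutive integers `i, i + 1` nor both of `1` and `n`. -/
def schrijverVertices (n k : ℕ) :
    Set {a : Finset ℕ // a ∈ Finset.powersetCard k (Finset.Icc 1 n)} :=
  {a | (∀ i : ℕ, ¬ ({i, i + 1} : Finset ℕ) ⊆ a.1) ∧ ¬ ({1, n} : Finset ℕ) ⊆ a.1}

/-- The Schrijver graph `SG(n,k)`, an induced subgraph of the Kneser graph. -/
def schrijverGraph (n k : ℕ) : SimpleGraph (schrijverVertices n k) :=
  (kneserGraph n k).induce (schrijverVertices n k)

/-- `G` contains an odd topological `K_r` subgraph: `r` distinct branching vertices `b i` and, for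
each pair `i < j`, a path of odd length from `b i` to `b j`, such that each path meets the branching
vertices only in its own two ends, and two different paths share no vertex other than a branching
vertex (hence only a common end). -/
def HasOddTopologicalComplete {V : Type*} (G : SimpleGraph V) (r : ℕ) : Prop :=
  ∃ (b : Fin r → V) (p : ∀ i j : Fin r, i < j → G.Walk (b i) (b j)),
    Function.Injective b ∧
    (∀ i j h, (p i j h).IsPath ∧ Odd (p i j h).length) ∧
    (∀ i j h l, b l ∈ (p i j h).support → l = i ∨ l = j) ∧
    (∀ i j h i' j' h', (i, j) ≠ (i', j') →
      ∀ v, v ∈ (p i j h).support → v ∈ (p i' j' h').support → v ∈ Set.range b)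

/-- `G` contains an odd `K_m` minor: `m` vertex-disjoint trees `T i` in `G` and a 2-colouring `c` of
their vertices (the values of `c` elsewhere are irrelevant) that is proper on each tree, such that
any two different trees are joined by an edge of `G` with equally coloured ends. -/
def HasOddCompleteMinor {V : Type*} (G : SimpleGraph V) (m : ℕ) : Prop :=
  ∃ (T : Fin m → G.Subgraph) (c : V → Bool),
    (∀ i, (T i).coe.IsTree) ∧
    (∀ i j, i ≠ j → Disjoint (T i).verts (T j).verts) ∧
    (∀ i u v, (T i).Adj u v → c u ≠ c v) ∧
    (∀ i j, i ≠ j → ∃ u ∈ (T i).verts, ∃ v ∈ (T j).verts, G.Adj u v ∧ c u = c v)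

/-! Write n = 2k + s and t = s + 2. Two k-sets whose elements alternate in increasing order are
disjoint, so adjacency can be read off interlacing enumerations. Every vertex used has a code (x, y,
h, e): its two least elements are x and y, its tail has step 2 with one extra unit of shift from
index h on, and e = 1 iff it contains n. For i < j ≤ s, the path from `b i` to `b j` alternates
between e = 0 and e = 1. Inside it x records i and y records j, while h climbs from 2 to k; once the
tail is entirely unshifted, one step leads to `b j`. Paths to the last branching vertex have length
1 or 3. A code is determined by its set, so the paths are internally disjoint
(`hasOddTopologicalComplete_schrijverGraph`). For odd minors, cut each path just before its end of
larger index. The pieces starting at one branching vertex form a tree, coloured by parity of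
position; odd length makes the cut edge monochromatic. -/

/-! ### Odd topological complete subgraphs yield odd complete minors -/

open SimpleGraph in
/-- A spanning tree of a connected subgraph, as a subgraph. -/
theorem SimpleGraph.Subgraph.Connected.exists_isTree_le {V : Type*} {G : SimpleGraph V}
    {H : G.Subgraph} (hH : H.Connected) :
    ∃ T : G.Subgraph, T.verts = H.verts ∧ (∀ u v, T.Adj u v → H.Adj u v) ∧ T.coe.IsTree := by
  obtain ⟨F, hF, hFT⟩ := hH.coe.exists_isTree_le
  let T : G.Subgraph :=
    { verts := H.verts
      Adj := fun u v => ∃ (hu : u ∈ H.verts) (hv : v ∈ H.verts), F.Adj ⟨u, hu⟩ ⟨v, hv⟩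
      adj_sub := fun ⟨_, _, h⟩ => H.adj_sub (hF h)
      edge_vert := fun ⟨hu, _, _⟩ => hu
      symm := ⟨fun _ _ ⟨hu, hv, h⟩ => ⟨hv, hu, h.symm⟩⟩ }
  have hT : T.coe = F := by
    ext ⟨u, hu⟩ ⟨v, hv⟩
    exact ⟨fun ⟨_, _, h⟩ => h, fun h => ⟨hu, hv, h⟩⟩
  exact ⟨T, rfl, fun u v ⟨_, _, h⟩ => hF h, hT ▸ hFT⟩

/-- The union of walks starting at a common vertex `a`, each without its last vertex. -/
def SimpleGraph.spider {V ι : Type*} (G : SimpleGraph V) (a : V) (e : ι → V)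
    (q : ∀ j, G.Walk a (e j)) : G.Subgraph where
  verts := {v | v = a ∨ ∃ j m, m < (q j).length ∧ (q j).getVert m = v}
  Adj u v := ∃ j m, m + 1 < (q j).length ∧
    (((q j).getVert m = u ∧ (q j).getVert (m + 1) = v) ∨
      ((q j).getVert m = v ∧ (q j).getVert (m + 1) = u))
  adj_sub := by
    rintro u v ⟨j, m, hm, ⟨rfl, rfl⟩ | ⟨rfl, rfl⟩⟩
    · exact (q j).adj_getVert_succ (by omega)
    · exact ((q j).adj_getVert_succ (by omega)).symm
  edge_vert := by
    rintro u v ⟨j, m, hm, ⟨rfl, rfl⟩ | ⟨rfl, rfl⟩⟩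
    · exact Or.inr ⟨j, m, by omega, rfl⟩
    · exact Or.inr ⟨j, m + 1, hm, rfl⟩
  symm := ⟨fun u v ⟨j, m, hm, h⟩ => ⟨j, m, hm, h.symm⟩⟩

theorem SimpleGraph.spider_connected {V ι : Type*} (G : SimpleGraph V) (a : V) (e : ι → V)
    (q : ∀ j, G.Walk a (e j)) : (G.spider a e q).Connected := by
  have ha : a ∈ (G.spider a e q).verts := Or.inl rfl
  have key : ∀ j m (hm : m < (q j).length), (G.spider a e q).coe.Reachable ⟨a, ha⟩
      ⟨(q j).getVert m, Or.inr ⟨j, m, hm, rfl⟩⟩ := by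
    intro j m
    induction m with
    | zero => intro hm; simp
    | succ m ih =>
      intro hm
      refine (ih (by omega)).trans (SimpleGraph.Adj.reachable ?_)
      exact ⟨j, m, hm, Or.inl ⟨rfl, rfl⟩⟩
  rw [SimpleGraph.Subgraph.connected_iff', SimpleGraph.connected_iff_exists_forall_reachable]
  refine ⟨⟨a, ha⟩, ?_⟩
  rintro ⟨v, rfl | ⟨j, m, hm, rfl⟩⟩
  · rfl
  · exact key j m hm

/-- An odd topological complete subgraph yields an odd complete minor. -/
theorem HasOddTopologicalComplete.hasOddCompleteMinor {V : Type*} {G : SimpleGraph V} {r : ℕ}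
    (h : HasOddTopologicalComplete G r) : HasOddCompleteMinor G r := by
  classical
  obtain ⟨b, p, hb, hp, hpb, hdisj⟩ := h
  have hinj : ∀ {i j h m m'}, m ≤ (p i j h).length → m' ≤ (p i j h).length →
      (p i j h).getVert m = (p i j h).getVert m' → m = m' := fun {i j h m m'} hm hm' e =>
    (hp i j h).1.getVert_injOn hm hm' e
  -- A path without its last vertex meets the branching vertices only at its start.
  have hrange : ∀ {i j h m}, m < (p i j h).length → (p i j h).getVert m ∈ Set.range b → m = 0 := by
    rintro i j h m hm ⟨l, hl⟩
    rcases hpb i j h l (hl ▸ (p i j h).getVert_mem_support m) with rfl | rfl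
    · exact hinj hm.le (Nat.zero_le _) (by simp [hl])
    · have := hinj hm.le le_rfl (by simp [← hl])
      omega
  have hsame : ∀ {i j h i' j' h' m m'}, m < (p i j h).length → m' < (p i' j' h').length →
      (p i j h).getVert m = (p i' j' h').getVert m' → m = m' ∧ i = i' := by
    intro i j h i' j' h' m m' hm hm' e
    by_cases hij : (i, j) = (i', j')
    · obtain ⟨rfl, rfl⟩ := Prod.mk.inj hij
      exact ⟨hinj hm.le hm'.le e, rfl⟩
    · have hr := hdisj i j h i' j' h' hij _ ((p i j h).getVert_mem_support m)
        (e ▸ (p i' j' h').getVert_mem_support m')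
      have h0 := hrange hm hr
      have h0' := hrange hm' (e ▸ hr)
      subst h0 h0'
      simp only [SimpleGraph.Walk.getVert_zero] at e
      exact ⟨rfl, hb e⟩
  choose T hTv hTa hT using fun i => (G.spider_connected (b i)
    (fun j : {j // i < j} => b j) (fun j => p i j j.2)).exists_isTree_le
  -- True at even positions; consistent because, by `hsame`, truncated paths share only their
  -- starts.
  let c : V → Bool := fun v => decide (v ∈ Set.range b ∨
    ∃ i j h m, m < (p i j h).length ∧ Even m ∧ (p i j h).getVert m = v)
  have hc : ∀ {i j h m}, m < (p i j h).length → (c ((p i j h).getVert m) = true ↔ Even m) := by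
    intro i j h m hm
    simp only [c, decide_eq_true_eq]
    constructor
    · rintro (hr | ⟨i', j', h', m', hm', he, e⟩)
      · simp [hrange hm hr]
      · rwa [(hsame hm hm' e.symm).1]
    · exact fun he => Or.inr ⟨i, j, h, m, hm, he, rfl⟩
  have hbT : ∀ i, b i ∈ (T i).verts := fun i => by rw [hTv]; exact Or.inl rfl
  have hedge : ∀ i j, i < j →
      ∃ u ∈ (T i).verts, ∃ v ∈ (T j).verts, G.Adj u v ∧ c u = c v := by
    intro i j hij
    -- The length is 2d + 1, so the penultimate vertex has even position 2d and the colour of `b j`.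
    obtain ⟨d, hd⟩ := (hp i j hij).2
    refine ⟨(p i j hij).getVert (2 * d), ?_, b j, hbT j, ?_, ?_⟩
    · rw [hTv]
      exact Or.inr ⟨⟨j, hij⟩, 2 * d, by simp [hd], rfl⟩
    · have := (p i j hij).adj_getVert_succ (i := 2 * d) (by omega)
      rwa [← hd, SimpleGraph.Walk.getVert_length] at this
    · rw [(hc (by omega)).2 (by simp)]
      simp [c]
  refine ⟨T, c, hT, ?_, ?_, ?_⟩
  · intro i j hij
    rw [Set.disjoint_left, hTv, hTv]
    have hsingle : ∀ {i i' j h m}, m < (p i j h).length → (p i j h).getVert m = b i' → i = i' := by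
      intro i i' j h m hm e
      have h0 := hrange hm ⟨i', e.symm⟩
      subst h0
      exact hb (by simpa using e)
    rintro v (rfl | ⟨j₁, m, hm, rfl⟩) (e | ⟨j₂, m', hm', e⟩)
    · exact hij (hb e)
    · exact hij (hsingle hm' e).symm
    · exact hij (hsingle hm e)
    · exact hij (hsame hm' hm e).2.symm
  · intro i u v huv
    obtain ⟨j, m, hm, h⟩ := hTa i u v huv
    beta_reduce at hm h
    have h1 := hc (show m < (p i j j.2).length by omega)
    have h2 := hc hm
    have h3 : c ((p i j j.2).getVert m) ≠ c ((p i j j.2).getVert (m + 1)) := by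
      intro e
      rw [e, h2] at h1
      rw [Nat.even_add_one] at h1
      tauto
    rcases h with ⟨rfl, rfl⟩ | ⟨rfl, rfl⟩
    · exact h3
    · exact h3.symm
  · intro i j hij
    rcases lt_or_gt_of_ne hij with h | h
    · exact hedge i j h
    · obtain ⟨u, hu, v, hv, ha, hcuv⟩ := hedge j i h
      exact ⟨v, hv, u, hu, ha.symm, hcuv.symm⟩

/-! ### Paths given by vertex sequences -/

/-- A sequence of successively adjacent vertices traces a walk. -/
theorem SimpleGraph.exists_walk_of_adj_succ {V : Type*} {G : SimpleGraph V} (w : ℕ → V) (L : ℕ)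
    (hw : ∀ m < L, G.Adj (w m) (w (m + 1))) :
    ∃ p : G.Walk (w 0) (w L), p.length = L ∧ p.support = (List.range (L + 1)).map w := by
  induction L with
  | zero => exact ⟨.nil, rfl, rfl⟩
  | succ L ih =>
    obtain ⟨p, hl, hs⟩ := ih fun m hm => hw m (by omega)
    refine ⟨p.concat (hw L (by omega)), by simp [hl], ?_⟩
    rw [SimpleGraph.Walk.support_concat, hs, List.range_succ (n := L + 1)]
    simp

/-- A description of odd topological complete subgraphs by vertex sequences. -/
theorem HasOddTopologicalComplete.of_sequences {V : Type*} {G : SimpleGraph V} {r : ℕ}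
    (b : Fin r → V) (L : Fin r → Fin r → ℕ) (w : Fin r → Fin r → ℕ → V)
    (hb : Function.Injective b)
    (hstart : ∀ i j, i < j → w i j 0 = b i) (hend : ∀ i j, i < j → w i j (L i j) = b j)
    (hodd : ∀ i j, i < j → Odd (L i j))
    (hadj : ∀ i j, i < j → ∀ m < L i j, G.Adj (w i j m) (w i j (m + 1)))
    (hbranch : ∀ i j, i < j → ∀ m, 0 < m → m < L i j → ∀ l, w i j m ≠ b l)
    (hinj : ∀ i j, i < j → ∀ i' j', i' < j' → ∀ m m', 0 < m → m < L i j → 0 < m' → m' < L i' j' →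
      w i j m = w i' j' m' → i = i' ∧ j = j' ∧ m = m') :
    HasOddTopologicalComplete G r := by
  have hwalk : ∀ i j, i < j → ∃ p : G.Walk (b i) (b j),
      p.length = L i j ∧ p.support = (List.range (L i j + 1)).map (w i j) := by
    intro i j h
    rw [← hstart i j h, ← hend i j h]
    exact SimpleGraph.exists_walk_of_adj_succ _ _ (hadj i j h)
  choose p hlen hsupp using hwalk
  have hmem : ∀ i j h v, v ∈ (p i j h).support →
      v = b i ∨ v = b j ∨ ∃ m, 0 < m ∧ m < L i j ∧ w i j m = v := by
    intro i j h v hv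
    rw [hsupp, List.mem_map] at hv
    obtain ⟨m, hm, rfl⟩ := hv
    rw [List.mem_range] at hm
    rcases Nat.eq_zero_or_pos m with rfl | h0
    · exact Or.inl (hstart i j h)
    · rcases Nat.lt_or_ge m (L i j) with h1 | h1
      · exact Or.inr (Or.inr ⟨m, h0, h1, rfl⟩)
      · obtain rfl : m = L i j := by omega
        exact Or.inr (Or.inl (hend i j h))
  refine ⟨b, p, hb, fun i j h => ⟨?_, hlen i j h ▸ hodd i j h⟩, ?_, ?_⟩
  · have hne : b i ≠ b j := fun e => h.ne (hb e)
    rw [SimpleGraph.Walk.isPath_def, hsupp]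
    refine List.Nodup.map_on ?_ List.nodup_range
    intro m hm m' hm' e
    rw [List.mem_range] at hm hm'
    have hs := hstart i j h
    have he := hend i j h
    have hcase : ∀ x < L i j + 1, x = 0 ∨ (0 < x ∧ x < L i j) ∨ x = L i j := by omega
    rcases hcase m hm with rfl | ⟨h0, h1⟩ | rfl <;>
      rcases hcase m' hm' with h0' | ⟨h0', h1'⟩ | h0'
    · exact h0'.symm
    · exact absurd (e.symm.trans hs) (hbranch i j h _ h0' h1' _)
    · subst h0'; exact absurd (hs.symm.trans (e.trans he)) hne
    · subst h0'; exact absurd (e.trans hs) (hbranch i j h _ h0 h1 _)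
    · exact (hinj i j h i j h m m' h0 h1 h0' h1' e).2.2
    · subst h0'; exact absurd (e.trans he) (hbranch i j h _ h0 h1 _)
    · subst h0'; exact absurd (hs.symm.trans (e.symm.trans he)) hne
    · exact absurd (e.symm.trans he) (hbranch i j h _ h0' h1' _)
    · exact h0'.symm
  · intro i j h l hl
    rcases hmem i j h _ hl with e | e | ⟨m, h0, h1, e⟩
    · exact Or.inl (hb e)
    · exact Or.inr (hb e)
    · exact absurd e (hbranch i j h m h0 h1 l)
  · intro i j h i' j' h' hne v hv hv'
    rcases hmem i j h v hv with rfl | rfl | ⟨m, h0, h1, e⟩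
    · exact ⟨_, rfl⟩
    · exact ⟨_, rfl⟩
    rcases hmem i' j' h' v hv' with rfl | rfl | ⟨m', h0', h1', e'⟩
    · exact ⟨_, rfl⟩
    · exact ⟨_, rfl⟩
    obtain ⟨rfl, rfl, -⟩ := hinj i j h i' j' h' m m' h0 h1 h0' h1' (e.trans e'.symm)
    exact absurd rfl hne

/-! ### Coding vertices of the Schrijver graph -/

/-- The increasing enumeration `x, y, s + 4 + e, s + 6 + e, …` in which all terms from the index
`h` on are shifted by one. -/
def shiftedSeq (s x y h e i : ℕ) : ℕ :=
  if i = 0 then x else if i = 1 then y else if i < h then s + 2 * i + e else s + 2 * i + 1 + e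

/-- Parameters for which `shiftedSeq` enumerates a vertex of `SG(2k + s, k)`, without repetition. -/
structure IsShiftCode (s k x y h e : ℕ) : Prop where
  two_le : 2 ≤ h
  add_le : h + e ≤ k
  lt : e < x
  add_two_le : x + 2 ≤ y
  le : y ≤ s + 3 + e
  le_of_lt : 2 < h → y ≤ s + 2 + e
  le_one : e ≤ 1

theorem IsShiftCode.lt_succ {s k x y h e : ℕ} (hc : IsShiftCode s k x y h e) (i : ℕ) :
    shiftedSeq s x y h e i + 2 ≤ shiftedSeq s x y h e (i + 1) := by
  obtain ⟨h1, h2, h3, h4, h5, h6, h7⟩ := hc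
  unfold shiftedSeq
  split_ifs <;> first | contradiction | omega

theorem IsShiftCode.strictMono {s k x y h e : ℕ} (hc : IsShiftCode s k x y h e) :
    StrictMono (shiftedSeq s x y h e) :=
  strictMono_nat_of_lt_succ fun i => by have := hc.lt_succ i; omega

/-- If e = 1, then h < k, so the last term is shifted and equals n; if e = 0, it stays below n. Thus
e can be read off the set, and `e < x` keeps 1 and n from occurring together. -/
theorem IsShiftCode.last {s k x y h e : ℕ} (hc : IsShiftCode s k x y h e) (hk : 3 ≤ k) :
    shiftedSeq s x y h e (k - 1) + 1 ≤ 2 * k + s + e ∧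
      (e = 1 → shiftedSeq s x y h e (k - 1) = 2 * k + s) := by
  obtain ⟨h1, h2, h3, h4, h5, h6, h7⟩ := hc
  unfold shiftedSeq
  split_ifs <;> first | contradiction | omega

theorem IsShiftCode.exists_vertex {s k x y h e : ℕ} (hc : IsShiftCode s k x y h e) (hk : 3 ≤ k) :
    ∃ v : schrijverVertices (2 * k + s) k,
      v.1.1 = (Finset.range k).image (shiftedSeq s x y h e) := by
  have hx : shiftedSeq s x y h e 0 = x := rfl
  obtain ⟨hl, -⟩ := hc.last hk
  have hmono := hc.strictMono
  have he := hc.lt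
  have he1 := hc.le_one
  have hlast : ∀ i < k, shiftedSeq s x y h e i ≤ shiftedSeq s x y h e (k - 1) := fun i hi =>
    hmono.monotone (by omega)
  have hfirst : ∀ i, x ≤ shiftedSeq s x y h e i := fun i => hx ▸ hmono.monotone (Nat.zero_le i)
  refine ⟨⟨⟨(Finset.range k).image (shiftedSeq s x y h e), ?_⟩, ?_, ?_⟩, rfl⟩
  · rw [Finset.mem_powersetCard, Finset.card_image_of_injective _ hmono.injective,
      Finset.card_range]
    refine ⟨fun z hz => ?_, rfl⟩
    simp only [Finset.mem_image, Finset.mem_range] at hz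
    obtain ⟨i, hi, rfl⟩ := hz
    have := hlast i hi
    have := hfirst i
    rw [Finset.mem_Icc]
    omega
  · intro z hz
    simp only [Finset.insert_subset_iff, Finset.singleton_subset_iff, Finset.mem_image,
      Finset.mem_range] at hz
    obtain ⟨⟨i, hi, hiz⟩, j, hj, hjz⟩ := hz
    have hij : i < j := hmono.lt_iff_lt.1 (by omega)
    have h1 : shiftedSeq s x y h e (i + 1) ≤ shiftedSeq s x y h e j := hmono.monotone hij
    have := hc.lt_succ i
    omega
  · intro hz
    simp only [Finset.insert_subset_iff, Finset.singleton_subset_iff, Finset.mem_image,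
      Finset.mem_range] at hz
    obtain ⟨⟨i, hi, hiz⟩, j, hj, hjz⟩ := hz
    have := hfirst i
    have := hlast j hj
    omega

/-- Strictly increasing sequences with the same set of first `k` terms agree in these terms. -/
theorem StrictMono.eq_of_image_range_eq {a b : ℕ → ℕ} (ha : StrictMono a) (hb : StrictMono b)
    {k : ℕ} (h : (Finset.range k).image a = (Finset.range k).image b) {i : ℕ} (hi : i < k) :
    a i = b i := by
  have key : ∀ {c : ℕ → ℕ} (hc : StrictMono c),
      (fun j : Fin k => c j) =
        ((Finset.range k).image c).orderEmbOfFin (by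
          rw [Finset.card_image_of_injective _ hc.injective, Finset.card_range]) := fun hc =>
    Finset.orderEmbOfFin_unique _
      (fun j => Finset.mem_image_of_mem _ (Finset.mem_range.2 j.2)) (fun _ _ h => hc h)
  have h1 := congrFun (key ha) ⟨i, hi⟩
  have h2 := congrFun (key hb) ⟨i, hi⟩
  simp only [h] at h1
  exact h1.trans h2.symm

/-- Interlacing increasing sequences have disjoint ranges. -/
theorem StrictMono.disjoint_image_of_interlacing {a b : ℕ → ℕ} (ha : StrictMono a)
    (hb : StrictMono b) {k : ℕ} (h1 : ∀ i < k, a i < b i) (h2 : ∀ i < k, b i < a (i + 1)) :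
    Disjoint ((Finset.range k).image a) ((Finset.range k).image b) := by
  rw [Finset.disjoint_left]
  intro z hz hz'
  simp only [Finset.mem_image, Finset.mem_range] at hz hz'
  obtain ⟨i, hi, rfl⟩ := hz
  obtain ⟨j, hj, e⟩ := hz'
  rcases Nat.lt_or_ge j i with h | h
  · have := ha.monotone (show j + 1 ≤ i from h)
    have := h2 j hj
    omega
  · have := hb.monotone h
    have := h1 i hi
    omega

/-- Reduces equality and adjacency of vertices to arithmetic of codes; invalid codes get an
arbitrary vertex. -/
theorem exists_shiftCode_vertexMap (s k : ℕ) (hk : 3 ≤ k) :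
    ∃ f : ℕ → ℕ → ℕ → ℕ → schrijverVertices (2 * k + s) k,
      (∀ x y h e x' y' h' e', IsShiftCode s k x y h e → IsShiftCode s k x' y' h' e' →
        f x y h e = f x' y' h' e' → x = x' ∧ y = y' ∧ h = h' ∧ e = e') ∧
      (∀ x y h e x' y' h' e', IsShiftCode s k x y h e → IsShiftCode s k x' y' h' e' →
        (∀ i < k, shiftedSeq s x y h e i < shiftedSeq s x' y' h' e' i) →
        (∀ i < k, shiftedSeq s x' y' h' e' i < shiftedSeq s x y h e (i + 1)) →
        (schrijverGraph (2 * k + s) k).Adj (f x y h e) (f x' y' h' e')) := by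
  classical
  obtain ⟨v₀, -⟩ := (show IsShiftCode s k 1 3 2 0 by constructor <;> omega).exists_vertex hk
  have hex : ∀ x y h e, ∃ v : schrijverVertices (2 * k + s) k, IsShiftCode s k x y h e →
      v.1.1 = (Finset.range k).image (shiftedSeq s x y h e) := by
    intro x y h e
    by_cases hc : IsShiftCode s k x y h e
    · obtain ⟨v, hv⟩ := hc.exists_vertex hk
      exact ⟨v, fun _ => hv⟩
    · exact ⟨v₀, fun h => absurd h hc⟩
  choose f hf using hex
  refine ⟨f, ?_, ?_⟩
  · intro x y h e x' y' h' e' hc hc' heq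
    have himg := hf x y h e hc
    rw [heq, hf x' y' h' e' hc'] at himg
    have hval : ∀ i < k, shiftedSeq s x' y' h' e' i = shiftedSeq s x y h e i := fun i hi =>
      hc'.strictMono.eq_of_image_range_eq hc.strictMono himg hi
    have h0 : x' = x := hval 0 (by omega)
    have h1 : y' = y := hval 1 (by omega)
    have hlast := hval (k - 1) (by omega)
    obtain ⟨hl, hl1⟩ := hc.last hk
    obtain ⟨hl', hl1'⟩ := hc'.last hk
    obtain ⟨a1, a2, a3, a4, a5, a6, a7⟩ := hc
    obtain ⟨b1, b2, b3, b4, b5, b6, b7⟩ := hc'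
    have he : e = e' := by omega
    refine ⟨h0.symm, h1.symm, ?_, he⟩
    by_contra hne
    rcases lt_or_gt_of_ne hne with hlt | hlt
    -- At the smaller of the two shift indices only one of the sequences is shifted.
    · have := hval h (by omega)
      unfold shiftedSeq at this
      split_ifs at this <;> first | contradiction | omega
    · have := hval h' (by omega)
      unfold shiftedSeq at this
      split_ifs at this <;> first | contradiction | omega
  · intro x y h e x' y' h' e' hc hc' h1 h2
    have hd : Disjoint (f x y h e).1.1 (f x' y' h' e').1.1 := by
      rw [hf _ _ _ _ hc, hf _ _ _ _ hc']
      exact hc.strictMono.disjoint_image_of_interlacing hc'.strictMono h1 h2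
    refine ⟨fun heq => ?_, hd⟩
    have hmem : x ∈ (f x y h e).1.1 := by
      rw [hf _ _ _ _ hc]
      exact Finset.mem_image.2 ⟨0, Finset.mem_range.2 (by omega), rfl⟩
    have heq' : (f x y h e).1 = (f x' y' h' e').1 := heq
    exact Finset.disjoint_left.1 hd hmem (heq' ▸ hmem)

/-! ### The branching vertices and the paths -/

/-- For `k ≥ 3` the graph `SG(2k + s, k)` has an odd topological complete subgraph on
`s + 2` branching vertices. -/
theorem hasOddTopologicalComplete_schrijverGraph (s k : ℕ) (hk : 3 ≤ k) :
    HasOddTopologicalComplete (schrijverGraph (2 * k + s) k) (s + 2) := by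
  obtain ⟨f, hinj, hadj⟩ := exists_shiftCode_vertexMap s k hk
  -- The tails interlace when h' ≤ h ≤ h' + 1; the disjunction puts y' below the third term of the
  -- first sequence.
  have hadj01 : ∀ x y h x' y' h', IsShiftCode s k x y h 0 → IsShiftCode s k x' y' h' 1 →
      (x < x' ∧ x' < y ∧ y < y' ∧ (y' ≤ s + 3 ∨ h = 2 ∧ y' ≤ s + 4) ∧ h' ≤ h ∧ h ≤ h' + 1) →
      (schrijverGraph (2 * k + s) k).Adj (f x y h 0) (f x' y' h' 1) := by
    rintro x y h x' y' h' hc hc' ⟨h1, h2, h3, h4, h5, h6⟩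
    have := hc.two_le
    have := hc'.two_le
    refine hadj _ _ _ _ _ _ _ _ hc hc' ?_ ?_ <;>
    · intro c hc
      unfold shiftedSeq
      split_ifs <;> first | contradiction | omega
  let b : ℕ → schrijverVertices (2 * k + s) k := fun i =>
    if i ≤ s then f (i + 1) (i + 3) 2 0 else f (s + 2) (s + 4) 2 1
  -- Raising h from 2 to k costs two steps per unit, and one more step reaches `b j`: 2(k - 2) + 1.
  let L : ℕ → ℕ → ℕ := fun i j => if j ≤ s then 2 * k - 3 else if i = s then 1 else 3
  let w : ℕ → ℕ → ℕ → schrijverVertices (2 * k + s) k := fun i j m =>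
    if m = 0 then b i
    else if m = L i j then b j
    else if j ≤ s then
      if m % 2 = 1 then f (i + 2) (j + 3) (2 + m / 2) 1 else f (i + 1) (j + 2) (2 + m / 2) 0
    else if m = 1 then f (i + 2) (s + 4) 2 1 else f (i + 1) (s + 3) 2 0
  have hb : ∀ i, i < s + 2 → ∃ x y e, b i = f x y 2 e ∧ IsShiftCode s k x y 2 e ∧
      ((i ≤ s ∧ x = i + 1 ∧ y = i + 3 ∧ e = 0) ∨
        (i = s + 1 ∧ x = s + 2 ∧ y = s + 4 ∧ e = 1)) := by
    intro i hi
    by_cases his : i ≤ s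
    · exact ⟨i + 1, i + 3, 0, if_pos his, by constructor <;> omega, by omega⟩
    · exact ⟨s + 2, s + 4, 1, if_neg his, by constructor <;> omega, by omega⟩
  have hw : ∀ i j, i < j → j < s + 2 → ∀ m, 0 < m → m < L i j →
      ∃ x y h e, w i j m = f x y h e ∧ IsShiftCode s k x y h e ∧
      ((j ≤ s ∧ m % 2 = 1 ∧ x = i + 2 ∧ y = j + 3 ∧ h = 2 + m / 2 ∧ e = 1) ∨
       (j ≤ s ∧ m % 2 = 0 ∧ x = i + 1 ∧ y = j + 2 ∧ h = 2 + m / 2 ∧ e = 0) ∨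
       (j = s + 1 ∧ i < s ∧ m = 1 ∧ x = i + 2 ∧ y = s + 4 ∧ h = 2 ∧ e = 1) ∨
       (j = s + 1 ∧ i < s ∧ m = 2 ∧ x = i + 1 ∧ y = s + 3 ∧ h = 2 ∧ e = 0)) := by
    intro i j hij hj m h0 hm
    simp only [w, if_neg h0.ne', if_neg hm.ne]
    simp only [L] at hm
    by_cases hjs : j ≤ s
    · simp only [if_pos hjs] at hm ⊢
      by_cases hodd : m % 2 = 1
      · exact ⟨_, _, _, _, if_pos hodd, by constructor <;> omega, by omega⟩
      · exact ⟨_, _, _, _, if_neg hodd, by constructor <;> omega, by omega⟩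
    · simp only [if_neg hjs] at hm ⊢
      have hi : i ≠ s := by
        rintro rfl
        simp only [if_true] at hm
        omega
      rw [if_neg hi] at hm
      by_cases h1 : m = 1
      · exact ⟨_, _, _, _, if_pos h1, by constructor <;> omega, by omega⟩
      · exact ⟨_, _, _, _, if_neg h1, by constructor <;> omega, by omega⟩
  have hL : ∀ i j, 0 < L i j := by
    intro i j
    simp only [L]
    split_ifs <;> first | contradiction | omega
  have hstart : ∀ i j, w i j 0 = b i := fun i j => if_pos rfl
  have hend : ∀ i j, w i j (L i j) = b j := fun i j => by
    simp only [w, if_neg (hL i j).ne', if_true]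
  refine HasOddTopologicalComplete.of_sequences (fun i => b i) (fun i j => L i j)
    (fun i j => w i j) ?_ (fun i j _ => hstart i j) (fun i j _ => hend i j) ?_ ?_ ?_ ?_
  · intro i j hij
    obtain ⟨x, y, e, h1, hc, h2⟩ := hb i i.2
    obtain ⟨x', y', e', h1', hc', h2'⟩ := hb j j.2
    have := hinj _ _ _ _ _ _ _ _ hc hc' (h1.symm.trans (Eq.trans hij h1'))
    exact Fin.ext (by omega)
  · intro i j hij
    simp only [L]
    split_ifs
    · exact ⟨k - 2, by omega⟩
    · exact ⟨0, rfl⟩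
    · exact ⟨1, rfl⟩
  · intro i j hij m hm
    have hij' : (i : ℕ) < j := hij
    have hj := j.2
    have hbi : b i = f (i + 1) (i + 3) 2 0 := if_pos (by omega)
    rcases Nat.lt_or_ge s j with hjs | hjs
    · have hbj : b j = f (s + 2) (s + 4) 2 1 := if_neg (by omega)
      rcases eq_or_ne (i : ℕ) s with his | his
      · have hL1 : L i j = 1 := by simp only [L, if_neg hjs.not_ge, if_pos his]
        obtain rfl : m = 0 := by omega
        have he := hend i j
        rw [hL1] at he
        rw [hstart, he, hbi, hbj]
        exact hadj01 _ _ _ _ _ _ (by constructor <;> omega) (by constructor <;> omega) (by omega)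
      · have hL3 : L i j = 3 := by simp only [L, if_neg hjs.not_ge, if_neg his]
        have he := hend i j
        rw [hL3] at he hm
        have hw1 : w i j 1 = f (i + 2) (s + 4) 2 1 := by simp [w, hL3, hjs.not_ge]
        have hw2 : w i j 2 = f (i + 1) (s + 3) 2 0 := by simp [w, hL3, hjs.not_ge]
        obtain rfl | rfl | rfl : m = 0 ∨ m = 1 ∨ m = 2 := by omega
        · rw [hstart, hw1, hbi]
          exact hadj01 _ _ _ _ _ _ (by constructor <;> omega) (by constructor <;> omega) (by omega)
        · rw [hw1, hw2]
          exact (hadj01 _ _ _ _ _ _ (by constructor <;> omega) (by constructor <;> omega)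
            (by omega)).symm
        · rw [he, hw2, hbj]
          exact hadj01 _ _ _ _ _ _ (by constructor <;> omega) (by constructor <;> omega) (by omega)
    · have hbj : b j = f (j + 1) (j + 3) 2 0 := if_pos hjs
      have hLk : L i j = 2 * k - 3 := by simp only [L, if_pos hjs]
      have hwodd : ∀ d, d + 3 ≤ k → w i j (2 * d + 1) = f (i + 2) (j + 3) (2 + d) 1 := by
        intro d hd
        have e1 : 2 * d + 1 ≠ 2 * k - 3 := by omega
        have e2 : (2 * d + 1) % 2 = 1 := by omega
        have e3 : (2 * d + 1) / 2 = d := by omega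
        simp only [w, hLk, if_neg e1, if_neg (Nat.succ_ne_zero _), if_pos hjs, if_pos e2, e3]
      have hweven : ∀ d, d + 3 ≤ k → w i j (2 * d + 2) = f (i + 1) (j + 2) (3 + d) 0 := by
        intro d hd
        have e1 : 2 * d + 2 ≠ 2 * k - 3 := by omega
        have e2 : ¬ (2 * d + 2) % 2 = 1 := by omega
        have e3 : 2 + (2 * d + 2) / 2 = 3 + d := by omega
        simp only [w, hLk, if_neg e1, if_neg (Nat.succ_ne_zero _), if_pos hjs, if_neg e2, e3]
      rw [hLk] at hm
      rcases Nat.eq_zero_or_pos m with rfl | h0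
      · rw [hstart, hwodd 0 (by omega), hbi]
        exact hadj01 _ _ _ _ _ _ (by constructor <;> omega) (by constructor <;> omega) (by omega)
      rcases Nat.even_or_odd' m with ⟨d, rfl | rfl⟩
      · obtain ⟨d, rfl⟩ : ∃ d', d = d' + 1 := ⟨d - 1, by omega⟩
        rw [show 2 * (d + 1) = 2 * d + 2 by ring, hweven d (by omega)]
        rcases Nat.lt_or_ge (d + 3) k with hd | hd
        · rw [show 2 * d + 2 + 1 = 2 * (d + 1) + 1 by ring, hwodd (d + 1) (by omega)]
          exact hadj01 _ _ _ _ _ _ (by constructor <;> omega) (by constructor <;> omega)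
            (by omega)
        -- Now h = k. Both codes have e = 0, but the unshifted tail s + 4, s + 6, … interlaces with
        -- the tail s + 5, s + 7, … of `b j`.
        · rw [show 2 * d + 2 + 1 = L i j by omega, hend, hbj]
          refine hadj _ _ _ _ _ _ _ _ (by constructor <;> omega) (by constructor <;> omega) ?_ ?_ <;>
          · intro c hc
            unfold shiftedSeq
            split_ifs <;> first | contradiction | omega
      · rw [hwodd d (by omega), show 2 * d + 1 + 1 = 2 * d + 2 by ring, hweven d (by omega)]
        exact (hadj01 _ _ _ _ _ _ (by constructor <;> omega) (by constructor <;> omega)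
          (by omega)).symm
  · intro i j hij m h0 hm l heq
    have hij' : (i : ℕ) < j := hij
    obtain ⟨x, y, h, e, h1, hc, h2⟩ := hw i j hij j.2 m h0 hm
    obtain ⟨x', y', e', h1', hc', h2'⟩ := hb l l.2
    have := hinj _ _ _ _ _ _ _ _ hc hc' (h1.symm.trans (Eq.trans heq h1'))
    omega
  · intro i j hij i' j' hij' m m' h0 hm h0' hm' heq
    obtain ⟨x, y, h, e, h1, hc, h2⟩ := hw i j hij j.2 m h0 hm
    obtain ⟨x', y', h', e', h1', hc', h2'⟩ := hw i' j' hij' j'.2 m' h0' hm'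
    have := hinj _ _ _ _ _ _ _ _ hc hc' (h1.symm.trans (Eq.trans heq h1'))
    have hj := j.2
    have hj' := j'.2
    rw [Fin.ext_iff, Fin.ext_iff]
    omega

theorem mainTheorem4 :
    (∀ t : ℕ, 5 ≤ t → ∃ N : ℕ, ∀ n k : ℕ, N ≤ n → (t : ℤ) = n - 2 * k + 2 →
      HasOddTopologicalComplete (schrijverGraph n k) t) ∧
    (∀ t : ℕ, 2 ≤ t → ∃ N : ℕ, ∀ n k : ℕ, N ≤ n → (t : ℤ) = n - 2 * k + 2 →
      HasOddCompleteMinor (schrijverGraph n k) t) := by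
  have key : ∀ t : ℕ, 2 ≤ t → ∀ n k : ℕ, t + 4 ≤ n → (t : ℤ) = n - 2 * k + 2 →
      HasOddTopologicalComplete (schrijverGraph n k) t := by
    intro t ht n k hn h
    obtain ⟨s, rfl⟩ : ∃ s, t = s + 2 := ⟨t - 2, by omega⟩
    obtain rfl : n = 2 * k + s := by omega
    -- n ≥ t + 4 = s + 6 gives k ≥ 3.
    exact hasOddTopologicalComplete_schrijverGraph s k (by omega)
  exact ⟨fun t ht => ⟨t + 4, key t (by omega)⟩,
    fun t ht => ⟨t + 4, fun n k hn h => (key t ht n k hn h).hasOddCompleteMinor⟩⟩
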